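/- Let $R$ be an associative ring with $1$, let $\mathcal C=(\mathcal C,\Delta,\varepsilon)$ be a coassociative $R$-coring with counit (an $R$-bimodule with $R$-bilinear $\Delta:\mathcal C\to\mathcal C\otimes_R\mathcal C$, $\Delta(c)=\sum c_1\otimes c_2$, and $\varepsilon:\mathcal C\to R$), and let ${}^*\mathcal C=\mathrm{Hom}_{R-}(\mathcal C,R)$ be its left dual ring, with product $(f\star g)(c)=\sum g(c_1f(c_2))$ and the $R$-bimodule structure $(rf)(c)=f(cr)$, $(fr)(c)=f(c)r$. Let $\mathcal A$ be an associative $R$-ring, not necessarily with unity (an $R$-bimodule with an associative $R$-bilinear multiplication $\mathcal A\otimes_R\mathcal A\to\mathcal A$), and let $\kappa:\mathcal A\to{}^*\mathcal C$ be an $R$-bilinear multiplicative map (that is, $(\mathcal A,\mathcal C)$ is a measuring left $R$-pairing); write $\langle a,c\rangle=\kappa(a)(c)$. Right $\mathcal A$-modules are right $R$-modules $M$ with an associative action for which $m\mapsto[a\mapsto ma]$ is a right $R$-linear map $M\to\mathrm{Hom}_{-R}(\mathcal A,M)$, where $(fr)(a)=f(ra)$ for $f\in\mathrm{Hom}_{-R}(\mathcal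 A,M)$; morphisms are the $R$-linear and $\mathcal A$-linear maps. $M$ is unital if $M\mathcal A=M$ and $\mathcal A$-faithful if $m\mathcal A=0$ implies $m=0$. It is $\mathcal C$-rational if for every $m\in M$ there is $\sum m_i\otimes c_i\in M\otimes_R\mathcal C$ with $ma=\sum m_i\langle a,c_i\rangle$ for all $a\in\mathcal A$. Let $\mathrm{Rat}^{\mathcal C}(\widetilde{\mathcal M}_{\mathcal A})$ and $\mathrm{Rat}^{\mathcal C}(\mathcal M_{\mathcal A})$ be the full subcategories of the $\mathcal C$-rational right $\mathcal A$-modules that are $\mathcal A$-faithful, respectively unital. View $\mathcal C$ as a right $\mathcal A$-module by $c\leftharpoonup a=\sum c_1\langle a,c_2\rangle$, and let $\sigma[\mathcal C_{\mathcal A}]$ be the full subcategory of the unital right $\mathcal A$-modules that are isomorphic to a submodule of a quotient of a direct sum of copies of $\mathcal C$. The same notions are used for ${}^*\mathcal C$ in place of $\mathcal A$, with $\kappa=\mathrm{id}$. Let $\mathcal M^{\mathcal C}$ be the category of right $\mathcal C$-comodules with injective coaction $M\to M\otimes_R\mathcal C$, $m\mapsto\sum m_{<0>}\otimes m_{<1>}$,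 and colinear maps. Suppose that ${}_R\mathcal C$ is locally projective (for every surjective map $\pi:L\to N$ of left $R$-modules, every left $R$-linear $g:\mathcal C\to N$ and every finitely generated left $R$-submodule $F\subseteq\mathcal C$ there is a left $R$-linear $g':\mathcal C\to L$ with $\pi g'|_F=g|_F$) and that $\kappa(\mathcal A)\subseteq{}^*\mathcal C$ is dense in the finite topology (the topology induced by the product topology of $R^{\mathcal C}$, $R$ discrete). Then $$\mathcal M^{\mathcal C}\simeq\mathrm{Rat}^{\mathcal C}(\widetilde{\mathcal M}_{\mathcal A})=\mathrm{Rat}^{\mathcal C}(\mathcal M_{\mathcal A})=\sigma[\mathcal C_{\mathcal A}]\simeq\mathrm{Rat}^{\mathcal C}(\widetilde{\mathcal M}_{{}^*\mathcal C})=\mathrm{Rat}^{\mathcal C}(\mathcal M_{{}^*\mathcal C})=\sigma[\mathcal C_{{}^*\mathcal C}].$$ Here each $\simeq$ is an isomorphism of categories which is the identity on underlying $R$-modules and on underlying maps: from $\mathcal M^{\mathcal C}$ to the modules over $\mathcal A$ (respectively ${}^*\mathcal C$) it is given by $ma=\sum m_{<0>}\langle a,m_{<1>}\rangle$, and from the ${}^*\mathcal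 C$-modules to the $\mathcal A$-modules by restriction of scalars along $\kappa$. -/

import Mathlib

open CategoryTheory MulOpposite

universe u v w w₁ w₂ w₃ w₄

namespace CoringPairing

noncomputable section

/-! Throughout, `R` is an associative unital ring, a right `R`-module is a `Module Rᵐᵒᵖ`, and an
`R`-bimodule carries `Module R`, `Module Rᵐᵒᵖ` and `SMulCommClass R Rᵐᵒᵖ`. Thus `op r • m` is the
element usually written `m r`. -/

/-! ### The tensor product over a noncommutative ring -/

section Tensor

variable (R : Type u) [Ring R]

/-- The relations `m r ⊗ n = m ⊗ r n`. -/
def balancedRel (M : Type w₁) (N : Type w₂) [AddCommGroup M] [AddCommGroup N]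
    [Module Rᵐᵒᵖ M] [Module R N] : AddSubgroup (TensorProduct ℤ M N) :=
  AddSubgroup.closure {t | ∃ (m : M) (r : R) (n : N),
    t = TensorProduct.tmul ℤ (op r • m) n - TensorProduct.tmul ℤ m (r • n)}

/-- The tensor product `M ⊗_R N` of a right `R`-module and a left `R`-module: the abelian group
`M ⊗_ℤ N` modulo the relations `m r ⊗ n = m ⊗ r n`. -/
def Tensor (M : Type w₁) (N : Type w₂) [AddCommGroup M] [AddCommGroup N]
    [Module Rᵐᵒᵖ M] [Module R N] : Type (max w₁ w₂) :=
  TensorProduct ℤ M N ⧸ balancedRel R M N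

namespace Tensor

variable {M : Type w₁} {N : Type w₂} [AddCommGroup M] [AddCommGroup N]
  [Module Rᵐᵒᵖ M] [Module R N]

instance : AddCommGroup (Tensor R M N) :=
  inferInstanceAs (AddCommGroup (TensorProduct ℤ M N ⧸ balancedRel R M N))

/-- The pure tensor `m ⊗ n`. -/
def tmul (m : M) (n : N) : Tensor R M N :=
  QuotientAddGroup.mk' (balancedRel R M N) (TensorProduct.tmul ℤ m n)

theorem tmul_add (m : M) (n n' : N) : tmul R m (n + n') = tmul R m n + tmul R m n' := by
  exact (congrArg (QuotientAddGroup.mk' (balancedRel R M N)) (TensorProduct.tmul_add m n n')).trans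
    (map_add _ _ _)

theorem add_tmul (m m' : M) (n : N) : tmul R (m + m') n = tmul R m n + tmul R m' n := by
  exact (congrArg (QuotientAddGroup.mk' (balancedRel R M N)) (TensorProduct.add_tmul m m' n)).trans
    (map_add _ _ _)

theorem smul_tmul (m : M) (r : R) (n : N) : tmul R (op r • m) n = tmul R m (r • n) := by
  rw [← sub_eq_zero]
  exact (QuotientAddGroup.eq_zero_iff (N := balancedRel R M N) _).2
    (AddSubgroup.subset_closure ⟨m, r, n, rfl⟩)

/-- The pure tensor as a biadditive map. -/
def mk : M →+ N →+ Tensor R M N :=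
  AddMonoidHom.mk' (fun m => AddMonoidHom.mk' (tmul R m) (tmul_add R m))
    (fun m m' => AddMonoidHom.ext fun n => add_tmul R m m' n)

@[simp] theorem mk_apply (m : M) (n : N) : mk R m n = tmul R m n := rfl

/-- The universal property: a biadditive map with `f (m r) n = f m (r n)` factors. -/
def lift {P : Type w₃} [AddCommGroup P] (f : M →+ N →+ P)
    (hf : ∀ (m : M) (r : R) (n : N), f (op r • m) n = f m (r • n)) : Tensor R M N →+ P :=
  QuotientAddGroup.lift (balancedRel R M N)
    (TensorProduct.liftAddHom f (fun r m n => by simp)) (by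
      unfold balancedRel
      rw [AddSubgroup.closure_le]
      rintro _ ⟨m, r, n, rfl⟩
      change _ = _
      rw [map_sub, TensorProduct.liftAddHom_tmul, TensorProduct.liftAddHom_tmul, hf, sub_self])

@[simp] theorem lift_tmul {P : Type w₃} [AddCommGroup P] (f : M →+ N →+ P)
    (hf : ∀ (m : M) (r : R) (n : N), f (op r • m) n = f m (r • n)) (m : M) (n : N) :
    lift R f hf (tmul R m n) = f m n := rfl

@[elab_as_elim]
theorem induction {p : Tensor R M N → Prop} (t : Tensor R M N)
    (tmul : ∀ m n, p (tmul R m n)) (zero : p 0) (add : ∀ x y, p x → p y → p (x + y)) : p t := by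
  obtain ⟨t, rfl⟩ := QuotientAddGroup.mk'_surjective (balancedRel R M N) t
  induction t using TensorProduct.induction_on with
  | zero => rw [map_zero]; exact zero
  | tmul m n => exact tmul m n
  | add x y hx hy => rw [map_add]; exact add _ _ hx hy

theorem addHom_ext {P : Type w₃} [AddCommGroup P] {f g : Tensor R M N →+ P}
    (h : ∀ m n, f (tmul R m n) = g (tmul R m n)) : f = g := by
  ext t
  induction t using induction with
  | tmul m n => exact h m n
  | zero => simp
  | add x y hx hy => simp [hx, hy]

theorem addHom_congr {P : Type w₃} [AddCommGroup P] (f g : Tensor R M N →+ P)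
    (t : Tensor R M N) (h : ∀ m n, f (tmul R m n) = g (tmul R m n)) : f t = g t :=
  DFunLike.congr_fun (addHom_ext R h) t

/-- The map `f ⊗ g`. -/
def map {M' : Type w₃} {N' : Type w₄} [AddCommGroup M'] [AddCommGroup N']
    [Module Rᵐᵒᵖ M'] [Module R N'] (f : M →ₗ[Rᵐᵒᵖ] M') (g : N →ₗ[R] N') :
    Tensor R M N →+ Tensor R M' N' :=
  lift R (AddMonoidHom.mk' (fun m => (mk R (f m)).comp g.toAddMonoidHom)
      (fun m m' => by ext n; simp))
    (fun m r n => by simp [smul_tmul])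

@[simp] theorem map_tmul {M' : Type w₃} {N' : Type w₄} [AddCommGroup M'] [AddCommGroup N']
    [Module Rᵐᵒᵖ M'] [Module R N'] (f : M →ₗ[Rᵐᵒᵖ] M') (g : N →ₗ[R] N') (m : M) (n : N) :
    map R f g (tmul R m n) = tmul R (f m) (g n) := rfl

section Right

variable [Module Rᵐᵒᵖ N] [SMulCommClass R Rᵐᵒᵖ N]

/-- Right multiplication by `r` on the second factor. -/
def rsmul (r : Rᵐᵒᵖ) : Tensor R M N →+ Tensor R M N :=
  map R LinearMap.id
    { toFun := fun n => r • n
      map_add' := smul_add r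
      map_smul' := fun s n => (smul_comm s r n).symm }

/-- If `N` is a bimodule, then `M ⊗_R N` is a right module through `(m ⊗ n) r = m ⊗ n r`. -/
instance : Module Rᵐᵒᵖ (Tensor R M N) where
  smul r t := rsmul R r t
  one_smul t := by
    change rsmul R 1 t = AddMonoidHom.id _ t
    refine DFunLike.congr_fun (addHom_ext R fun m n => ?_) t
    change tmul R m ((1 : Rᵐᵒᵖ) • n) = _
    rw [one_smul]; rfl
  mul_smul r s t := by
    change rsmul R (r * s) t = ((rsmul R r).comp (rsmul R s)) t
    refine DFunLike.congr_fun (addHom_ext R fun m n => ?_) t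
    change tmul R m ((r * s) • n) = tmul R m (r • s • n)
    rw [mul_smul]
  smul_zero r := map_zero (rsmul R r)
  smul_add r := map_add (rsmul R r)
  add_smul r s t := by
    change rsmul R (r + s) t = (rsmul R r + rsmul R s : Tensor R M N →+ Tensor R M N) t
    refine DFunLike.congr_fun (addHom_ext R fun m n => ?_) t
    change tmul R m ((r + s) • n) = tmul R m (r • n) + tmul R m (s • n)
    rw [add_smul, tmul_add]
  zero_smul t := by
    change rsmul R 0 t = (0 : Tensor R M N →+ Tensor R M N) t
    refine DFunLike.congr_fun (addHom_ext R fun m n => ?_) t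
    change tmul R m ((0 : Rᵐᵒᵖ) • n) = 0
    rw [zero_smul]; exact map_zero (mk R m)

@[simp] theorem op_smul_tmul (r : Rᵐᵒᵖ) (m : M) (n : N) :
    r • tmul R m n = tmul R m (r • n) := rfl

end Right

section Left

variable [Module R M] [SMulCommClass R Rᵐᵒᵖ M]

/-- Left multiplication by `r` on the first factor. -/
def lsmul (r : R) : Tensor R M N →+ Tensor R M N :=
  map R
    { toFun := fun m => r • m
      map_add' := smul_add r
      map_smul' := fun s m => smul_comm r s m } LinearMap.id

/-- If `M` is a bimodule, then `M ⊗_R N` is a left module through `r (m ⊗ n) = r m ⊗ n`. -/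
instance : Module R (Tensor R M N) where
  smul r t := lsmul R r t
  one_smul t := by
    change lsmul R 1 t = AddMonoidHom.id _ t
    refine DFunLike.congr_fun (addHom_ext R fun m n => ?_) t
    change tmul R ((1 : R) • m) n = _
    rw [one_smul]; rfl
  mul_smul r s t := by
    change lsmul R (r * s) t = ((lsmul R r).comp (lsmul R s)) t
    refine DFunLike.congr_fun (addHom_ext R fun m n => ?_) t
    change tmul R ((r * s) • m) n = tmul R (r • s • m) n
    rw [mul_smul]
  smul_zero r := map_zero (lsmul R r)
  smul_add r := map_add (lsmul R r)
  add_smul r s t := by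
    change lsmul R (r + s) t = (lsmul R r + lsmul R s : Tensor R M N →+ Tensor R M N) t
    refine DFunLike.congr_fun (addHom_ext R fun m n => ?_) t
    change tmul R ((r + s) • m) n = tmul R (r • m) n + tmul R (s • m) n
    rw [add_smul, add_tmul]
  zero_smul t := by
    change lsmul R 0 t = (0 : Tensor R M N →+ Tensor R M N) t
    refine DFunLike.congr_fun (addHom_ext R fun m n => ?_) t
    change tmul R ((0 : R) • m) n = 0
    rw [zero_smul]; exact DFunLike.congr_fun (map_zero (mk R)) n

@[simp] theorem left_smul_tmul (r : R) (m : M) (n : N) :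
    r • tmul R m n = tmul R (r • m) n := rfl

end Left

/-- The map `t ↦ p ↦ assoc (t ⊗ p)`. -/
def assocAux [Module Rᵐᵒᵖ N] [SMulCommClass R Rᵐᵒᵖ N] {P : Type w₃} [AddCommGroup P]
    [Module R P] : Tensor R M N →+ P →+ Tensor R M (Tensor R N P) :=
  lift R
    (AddMonoidHom.mk'
      (fun m => AddMonoidHom.mk' (fun n => (mk R m).comp (mk R n))
        (fun n n' => by ext p; simp [tmul_add]))
      (fun m m' => by ext n p; simp))
    (fun m r n => by
      ext p
      change tmul R (op r • m) (tmul R n p) = tmul R m (tmul R (r • n) p)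
      rw [smul_tmul, left_smul_tmul])

/-- The associativity map `(M ⊗_R N) ⊗_R P → M ⊗_R (N ⊗_R P)`, `(m ⊗ n) ⊗ p ↦ m ⊗ (n ⊗ p)`. -/
def assoc [Module Rᵐᵒᵖ N] [SMulCommClass R Rᵐᵒᵖ N] {P : Type w₃} [AddCommGroup P] [Module R P] :
    Tensor R (Tensor R M N) P →+ Tensor R M (Tensor R N P) :=
  lift R (assocAux R)
    (fun t r p => by
      refine addHom_congr R (((assocAux R).flip p).comp (rsmul R (op r)))
        ((assocAux R).flip (r • p)) t fun m n => ?_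
      change tmul R m (tmul R (op r • n) p) = tmul R m (tmul R n (r • p))
      rw [smul_tmul])

@[simp] theorem assoc_tmul [Module Rᵐᵒᵖ N] [SMulCommClass R Rᵐᵒᵖ N] {P : Type w₃}
    [AddCommGroup P] [Module R P] (m : M) (n : N) (p : P) :
    assoc R (tmul R (tmul R m n) p) = tmul R m (tmul R n p) := rfl

/-- For `f ∈ Hom_{R-}(N, R)`, the map `M ⊗_R N → M`, `m ⊗ n ↦ m f(n)`. -/
def evalRight (f : N →ₗ[R] R) : Tensor R M N →+ M :=
  lift R (AddMonoidHom.mk'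
      (fun m => AddMonoidHom.mk' (fun n => op (f n) • m) (fun n n' => by simp [add_smul]))
      (fun m m' => by ext n; simp))
    (fun m r n => by simp [mul_smul])

@[simp] theorem evalRight_tmul (f : N →ₗ[R] R) (m : M) (n : N) :
    evalRight R f (tmul R m n) = op (f n) • m := rfl

/-- For `f ∈ Hom_{-R}(M, R)`, the map `M ⊗_R N → N`, `m ⊗ n ↦ f(m) n`. -/
def evalLeft (f : M →ₗ[Rᵐᵒᵖ] R) : Tensor R M N →+ N :=
  lift R (AddMonoidHom.mk'
      (fun m => AddMonoidHom.mk' (fun n => f m • n) (fun n n' => by simp))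
      (fun m m' => by ext n; simp [add_smul]))
    (fun m r n => by simp [mul_smul])

@[simp] theorem evalLeft_tmul (f : M →ₗ[Rᵐᵒᵖ] R) (m : M) (n : N) :
    evalLeft R f (tmul R m n) = f m • n := rfl

theorem evalRight_left_smul [Module R M] [SMulCommClass R Rᵐᵒᵖ M] (f : N →ₗ[R] R) (r : R)
    (t : Tensor R M N) : evalRight R f (r • t) = r • evalRight R f t := by
  induction t using induction with
  | tmul m n => simp [smul_comm]
  | zero => simp
  | add x y hx hy => simp [hx, hy]

end Tensor

end Tensor

/-! ### Rings over `R` and corings -/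

/-- An associative `R`-ring, not necessarily with unity: an `R`-bimodule `A` with an associative
multiplication which is `R`-bilinear on `A ⊗_R A`. -/
class RRing (R : Type u) (A : Type v) [Ring R] [NonUnitalRing A] [Module R A] [Module Rᵐᵒᵖ A] :
    Prop where
  smul_op_smul : ∀ (r s : R) (a : A), r • op s • a = op s • r • a
  smul_mul : ∀ (r : R) (a b : A), (r • a) * b = r • (a * b)
  mul_op_smul : ∀ (r : R) (a b : A), a * (op r • b) = op r • (a * b)
  op_smul_mul : ∀ (r : R) (a b : A), (op r • a) * b = a * (r • b)

/-- A morphism of `R`-rings (without unity): an `R`-bilinear multiplicative map. -/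
structure RRingHom (R : Type u) (A : Type v) (B : Type w) [Ring R]
    [NonUnitalRing A] [Module R A] [Module Rᵐᵒᵖ A]
    [NonUnitalRing B] [Module R B] [Module Rᵐᵒᵖ B] extends A →ₙ+* B where
  map_smul : ∀ (r : R) (a : A), toFun (r • a) = r • toFun a
  map_op_smul : ∀ (r : R) (a : A), toFun (op r • a) = op r • toFun a

/-- The identity morphism of an `R`-ring. -/
def RRingHom.id (R : Type u) (A : Type v) [Ring R]
    [NonUnitalRing A] [Module R A] [Module Rᵐᵒᵖ A] : RRingHom R A A where
  toNonUnitalRingHom := NonUnitalRingHom.id A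
  map_smul _ _ := rfl
  map_op_smul _ _ := rfl

/-- A coassociative `R`-coring with counit, on an `R`-bimodule `C`. -/
class Coring (R : Type u) (C : Type w) [Ring R] [AddCommGroup C] [Module R C] [Module Rᵐᵒᵖ C]
    [SMulCommClass R Rᵐᵒᵖ C] where
  /-- The comultiplication, with its right linearity. -/
  comul : C →ₗ[Rᵐᵒᵖ] Tensor R C C
  comul_smul : ∀ (r : R) (c : C), comul (r • c) = r • comul c
  /-- The counit, with its left linearity. -/
  counit : C →ₗ[R] R
  counit_op_smul : ∀ (r : R) (c : C), counit (op r • c) = counit c * r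
  coassoc : ∀ c : C,
    Tensor.assoc R (Tensor.map R comul LinearMap.id (comul c)) =
      Tensor.map R LinearMap.id { comul with map_smul' := comul_smul } (comul c)
  /-- `∑ c₁ ε(c₂) = c` -/
  counit_right : ∀ c : C, Tensor.evalRight R counit (comul c) = c
  /-- `∑ ε(c₁) c₂ = c` -/
  counit_left : ∀ c : C,
    Tensor.evalLeft R { counit with map_smul' := fun r c => counit_op_smul r.unop c } (comul c) = c

/-- The comultiplication as a left linear map. -/
def comulLeft (R : Type u) (C : Type w) [Ring R] [AddCommGroup C] [Module R C] [Module Rᵐᵒᵖ C]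
    [SMulCommClass R Rᵐᵒᵖ C] [Coring R C] : C →ₗ[R] Tensor R C C :=
  { (Coring.comul : C →ₗ[Rᵐᵒᵖ] Tensor R C C) with map_smul' := Coring.comul_smul }

section Coring

variable (R : Type u) (C : Type w) [Ring R] [AddCommGroup C] [Module R C]

/-- The left dual `*C = Hom_{R-}(C, R)`. -/
def LeftDual : Type (max u w) := C →ₗ[R] R

namespace LeftDual

instance : AddCommGroup (LeftDual R C) := inferInstanceAs (AddCommGroup (C →ₗ[R] R))

instance : FunLike (LeftDual R C) C R := inferInstanceAs (FunLike (C →ₗ[R] R) C R)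

variable {R C}

@[ext] theorem ext {f g : LeftDual R C} (h : ∀ c, f c = g c) : f = g := LinearMap.ext h

/-- The underlying linear map. -/
def toLin (f : LeftDual R C) : C →ₗ[R] R := f

@[simp] theorem toLin_apply (f : LeftDual R C) (c : C) : f.toLin c = f c := rfl
@[simp] theorem add_apply (f g : LeftDual R C) (c : C) : (f + g) c = f c + g c := rfl
@[simp] theorem zero_apply (c : C) : (0 : LeftDual R C) c = 0 := rfl
@[simp] theorem map_add' (f : LeftDual R C) (c d : C) : f (c + d) = f c + f d :=
  LinearMap.map_add f.toLin c d
@[simp] theorem map_smul' (f : LeftDual R C) (r : R) (c : C) : f (r • c) = r * f c :=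
  LinearMap.map_smul f.toLin r c

/-- The right action `(f r)(c) = f(c) r`. -/
instance : Module Rᵐᵒᵖ (LeftDual R C) := inferInstanceAs (Module Rᵐᵒᵖ (C →ₗ[R] R))

@[simp] theorem op_smul_apply (r : R) (f : LeftDual R C) (c : C) : (op r • f) c = f c * r := rfl

theorem evalRight_add {M : Type w₁} [AddCommGroup M] [Module Rᵐᵒᵖ M] (f g : LeftDual R C)
    (t : Tensor R M C) : Tensor.evalRight R (f + g).toLin t =
      Tensor.evalRight R f.toLin t + Tensor.evalRight R g.toLin t := by
  rw [← AddMonoidHom.add_apply]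
  refine DFunLike.congr_fun (Tensor.addHom_ext R fun m n => ?_) t
  simp [add_smul]

theorem evalRight_op_smul {M : Type w₁} [AddCommGroup M] [Module Rᵐᵒᵖ M] (r : R)
    (f : LeftDual R C) (t : Tensor R M C) :
    Tensor.evalRight R (op r • f).toLin t = op r • Tensor.evalRight R f.toLin t := by
  induction t using Tensor.induction with
  | tmul m n => simp [mul_smul]
  | zero => simp
  | add x y hx hy => simp only [map_add, smul_add, hx, hy]

theorem evalRight_map {M : Type w₁} {M' : Type w₂} [AddCommGroup M] [Module Rᵐᵒᵖ M]
    [AddCommGroup M'] [Module Rᵐᵒᵖ M'] (φ : M →ₗ[Rᵐᵒᵖ] M') (f : LeftDual R C)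
    (t : Tensor R M C) :
    Tensor.evalRight R f.toLin (Tensor.map R φ LinearMap.id t) =
      φ (Tensor.evalRight R f.toLin t) := by
  induction t using Tensor.induction with
  | tmul m n => simp
  | zero => simp
  | add x y hx hy => simp only [map_add, hx, hy]

variable [Module Rᵐᵒᵖ C] [SMulCommClass R Rᵐᵒᵖ C]

/-- The left action `(r f)(c) = f(c r)`. -/
instance : Module R (LeftDual R C) where
  smul r f :=
    ({ toFun := fun c => f (op r • c)
       map_add' := fun c d => by simp
       map_smul' := fun s c => by rw [← smul_comm]; simp } : C →ₗ[R] R)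
  one_smul f := by ext c; change f (op (1 : R) • c) = f c; simp
  mul_smul r s f := by
    ext c; change f (op (r * s) • c) = f (op s • op r • c); rw [op_mul, mul_smul]
  smul_zero r := by ext c; rfl
  smul_add r f g := by ext c; rfl
  add_smul r s f := by
    ext c; change f (op (r + s) • c) = f (op r • c) + f (op s • c)
    rw [MulOpposite.op_add, add_smul, map_add']
  zero_smul f := by
    ext c; change f (op (0 : R) • c) = 0
    rw [op_zero, zero_smul]; exact LinearMap.map_zero f.toLin

@[simp] theorem smul_apply (r : R) (f : LeftDual R C) (c : C) : (r • f) c = f (op r • c) := rfl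

theorem evalRight_smul {M : Type w₁} [AddCommGroup M] [Module Rᵐᵒᵖ M] (r : R)
    (f : LeftDual R C) (t : Tensor R M C) :
    Tensor.evalRight R (r • f).toLin t = Tensor.evalRight R f.toLin (op r • t) := by
  induction t using Tensor.induction with
  | tmul m n => simp
  | zero => simp
  | add x y hx hy => simp only [map_add, smul_add, hx, hy]

variable [Coring R C]

/-- The map `C → C`, `c ↦ ∑ c₁ f(c₂)`, as a left linear map. -/
def act (f : LeftDual R C) : C →ₗ[R] C where
  toFun c := Tensor.evalRight R f.toLin (Coring.comul c)
  map_add' c d := by rw [map_add, map_add]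
  map_smul' r c := by rw [Coring.comul_smul, Tensor.evalRight_left_smul]; rfl

/-- The product `(f ⋆ g)(c) = ∑ g(c₁ f(c₂))`. -/
instance : Mul (LeftDual R C) := ⟨fun f g => g.toLin.comp f.act⟩

theorem mul_apply (f g : LeftDual R C) (c : C) :
    (f * g) c = g (Tensor.evalRight R f.toLin (Coring.comul c)) := rfl

/-- If `ϱ : M → M ⊗_R C` is coassociative, then `m · a = ∑ m₀ a(m₁)` is an action of `*C`. -/
theorem evalRight_mul {M : Type w₁} [AddCommGroup M] [Module Rᵐᵒᵖ M]
    (ϱ : M →ₗ[Rᵐᵒᵖ] Tensor R M C)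
    (h : ∀ m, Tensor.assoc R (Tensor.map R ϱ LinearMap.id (ϱ m)) =
      Tensor.map R LinearMap.id (comulLeft R C) (ϱ m)) (f g : LeftDual R C) (m : M) :
    Tensor.evalRight R (f * g).toLin (ϱ m) =
      Tensor.evalRight R g.toLin (ϱ (Tensor.evalRight R f.toLin (ϱ m))) := by
  let E : Tensor R C C →ₗ[R] R :=
    { toFun := fun t => g (Tensor.evalRight R f.toLin t)
      map_add' := fun s t => by simp
      map_smul' := fun r t => by simp [Tensor.evalRight_left_smul] }
  have h1 : ∀ t : Tensor R M C, Tensor.evalRight R E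
      (Tensor.map R LinearMap.id (comulLeft R C) t) = Tensor.evalRight R (f * g).toLin t := by
    intro t
    exact Tensor.addHom_congr R ((Tensor.evalRight R E).comp
      (Tensor.map R LinearMap.id (comulLeft R C))) (Tensor.evalRight R (f * g).toLin) t
      fun m n => rfl
  have h2 : ∀ t : Tensor R (Tensor R M C) C, Tensor.evalRight R E (Tensor.assoc R t) =
      Tensor.evalRight R g.toLin (Tensor.evalRight R f.toLin t) := by
    intro t
    refine Tensor.addHom_congr R ((Tensor.evalRight R E).comp (Tensor.assoc R))
      ((Tensor.evalRight R g.toLin).comp (Tensor.evalRight R f.toLin)) t fun s c => ?_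
    simp only [AddMonoidHom.comp_apply]
    induction s using Tensor.induction with
    | tmul m n => simp [E]
    | zero => rw [show Tensor.tmul R (0 : Tensor R M C) c = 0 from
        DFunLike.congr_fun (map_zero (Tensor.mk R)) c]; simp only [map_zero]
    | add x y hx hy => rw [Tensor.add_tmul]; simp only [map_add, hx, hy]
  rw [← h1, ← h, h2, evalRight_map]

/-- `(*C, ⋆)` is an associative ring. -/
instance : NonUnitalRing (LeftDual R C) where
  left_distrib f g h := by ext c; rfl
  right_distrib f g h := by
    ext c
    simp only [mul_apply, add_apply, evalRight_add, map_add']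
  zero_mul f := by
    ext c
    have h : Tensor.evalRight R (0 : LeftDual R C).toLin (Coring.comul c) = 0 := by
      have := evalRight_add (0 : LeftDual R C) 0 (Coring.comul c)
      rwa [add_zero, left_eq_add] at this
    rw [mul_apply, h]; exact LinearMap.map_zero f.toLin
  mul_zero f := by ext c; rfl
  mul_assoc f g h := by
    ext c
    rw [mul_apply, mul_apply, mul_apply]
    exact congrArg h (evalRight_mul Coring.comul Coring.coassoc f g c)

/-- `(*C, ⋆)` is an `R`-ring. -/
instance : RRing R (LeftDual R C) where
  smul_op_smul r s f := rfl
  smul_mul r f g := by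
    ext c
    rw [mul_apply, evalRight_smul, smul_apply, mul_apply, LinearMap.map_smul]
  mul_op_smul r f g := rfl
  op_smul_mul r f g := by
    ext c
    rw [mul_apply, evalRight_op_smul, mul_apply, smul_apply]

end LeftDual

/-- The finite topology on `*C`: the topology induced by the product topology on `R^C`, where
`R` is discrete. -/
@[reducible] def finiteTopology : TopologicalSpace (LeftDual R C) :=
  TopologicalSpace.induced (fun f c => f c) (@Pi.topologicalSpace C (fun _ => R) (fun _ => ⊥))

end Coring

/-- Local projectivity of a left `R`-module `W`: for every surjection `π : L → N`, every
`g : W → N` and every finitely generated `F ⊆ W` there is `g' : W → L` with `π ∘ g' = g` on `F`. -/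
def IsLocallyProjective (R : Type u) (W : Type w) [Ring R] [AddCommGroup W] [Module R W] : Prop :=
  ∀ (L N : Type (max u w)) [AddCommGroup L] [AddCommGroup N] [Module R L] [Module R N]
    (π : L →ₗ[R] N) (g : W →ₗ[R] N) (F : Submodule R W),
    Function.Surjective π → F.FG → ∃ g' : W →ₗ[R] L, ∀ x ∈ F, π (g' x) = g x

/-! ### Right modules over an `R`-ring -/

section Modules

variable (R : Type u) (A : Type v) [Ring R] [NonUnitalRing A] [Module R A] [Module Rᵐᵒᵖ A]

/-- A right module over an `R`-ring `A` without unity: a right `R`-module with an associative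
action of `A` for which `m ↦ [a ↦ m a]` is a right `R`-linear map `M → Hom_{-R}(A, M)`. -/
structure RightMod where
  carrier : Type w
  [addCommGroup : AddCommGroup carrier]
  [module : Module Rᵐᵒᵖ carrier]
  act : carrier →+ A →+ carrier
  act_op_smul : ∀ (m : carrier) (a : A) (r : R), act m (op r • a) = op r • act m a
  op_smul_act : ∀ (m : carrier) (a : A) (r : R), act (op r • m) a = act m (r • a)
  act_mul : ∀ (m : carrier) (a b : A), act m (a * b) = act (act m a) b

attribute [instance] RightMod.addCommGroup RightMod.module

variable {R A}

namespace RightMod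

/-- An `A`-linear map (which is also right `R`-linear). -/
@[ext] structure Hom (M N : RightMod.{u, v, w} R A) where
  toLin : M.carrier →ₗ[Rᵐᵒᵖ] N.carrier
  map_act : ∀ m a, toLin (M.act m a) = N.act (toLin m) a

instance : Category (RightMod.{u, v, w} R A) where
  Hom := Hom
  id M := ⟨LinearMap.id, fun _ _ => rfl⟩
  comp f g := ⟨g.toLin.comp f.toLin, fun m a => by
    simp only [LinearMap.comp_apply, f.map_act, g.map_act]⟩

/-- `M` is unital: `M A = M`. -/
def IsUnital (M : RightMod.{u, v, w} R A) : Prop :=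
  AddSubgroup.closure {x : M.carrier | ∃ m a, x = M.act m a} = ⊤

/-- `M` is `A`-faithful: `m ↦ [a ↦ m a]` is injective. -/
def IsFaithful (M : RightMod.{u, v, w} R A) : Prop :=
  Function.Injective fun (m : M.carrier) (a : A) => M.act m a

/-- The direct sum `K^(Λ)`. -/
def directSum (K : RightMod.{u, v, w} R A) (Λ : Type w) : RightMod.{u, v, w} R A where
  carrier := Λ →₀ K.carrier
  act := AddMonoidHom.mk'
    (fun x => AddMonoidHom.mk'
      (fun a => x.mapRange (fun k => K.act k a) (by simp))
      (fun a b => by ext i; simp))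
    (fun x y => by ext a i; simp)
  act_op_smul x a r := by ext i; simp [K.act_op_smul]
  op_smul_act x a r := by ext i; simp [K.op_smul_act]
  act_mul x a b := by ext i; simp [K.act_mul]

/-- `G` is `K`-generated: a quotient of a direct sum of copies of `K`. -/
def IsGenerated (K G : RightMod.{u, v, w} R A) : Prop :=
  ∃ (Λ : Type w) (p : K.directSum Λ ⟶ G), Function.Surjective (Hom.toLin p)

/-- `N` is `K`-subgenerated: isomorphic to a submodule of a `K`-generated module. -/
def IsSubgenerated (K N : RightMod.{u, v, w} R A) : Prop :=
  ∃ (G : RightMod.{u, v, w} R A) (i : N ⟶ G), K.IsGenerated G ∧ Function.Injective (Hom.toLin i)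

/-- `σ[K_A]`: the full subcategory of the unital modules that are `K`-subgenerated. -/
def sigma (K : RightMod.{u, v, w} R A) : ObjectProperty (RightMod.{u, v, w} R A) :=
  fun N => N.IsUnital ∧ K.IsSubgenerated N

/-- Restriction of scalars along a morphism of `R`-rings. -/
def restrict {A' : Type w₁} [NonUnitalRing A'] [Module R A'] [Module Rᵐᵒᵖ A']
    (κ : RRingHom R A A') : RightMod.{u, w₁, w} R A' ⥤ RightMod.{u, v, w} R A where
  obj M :=
    { carrier := M.carrier
      act := AddMonoidHom.mk' (fun m => (M.act m).comp κ.toNonUnitalRingHom.toAddMonoidHom)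
        (fun m m' => by ext a; simp)
      act_op_smul := fun m a r =>
        (congrArg (M.act m) (κ.map_op_smul r a)).trans (M.act_op_smul m _ r)
      op_smul_act := fun m a r =>
        (M.op_smul_act m _ r).trans (congrArg (M.act m) (κ.map_smul r a).symm)
      act_mul := fun m a b =>
        (congrArg (M.act m) (κ.map_mul' a b)).trans (M.act_mul m _ _) }
  map f := ⟨f.toLin, fun m a => f.map_act m _⟩

end RightMod

end Modules

/-! ### Comodules -/

section Comodules

variable (R : Type u) (C : Type w) [Ring R] [AddCommGroup C] [Module R C] [Module Rᵐᵒᵖ C]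
  [SMulCommClass R Rᵐᵒᵖ C] [Coring R C]

/-- A counital right `C`-comodule: a right `R`-module with an injective coassociative coaction. -/
structure Comod where
  carrier : Type w
  [addCommGroup : AddCommGroup carrier]
  [module : Module Rᵐᵒᵖ carrier]
  coact : carrier →ₗ[Rᵐᵒᵖ] Tensor R carrier C
  coassoc : ∀ m : carrier, Tensor.assoc R (Tensor.map R coact LinearMap.id (coact m)) =
    Tensor.map R LinearMap.id (comulLeft R C) (coact m)
  counital : Function.Injective coact

attribute [instance] Comod.addCommGroup Comod.module

variable {R C}

namespace Comod

/-- A colinear map. -/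
@[ext] structure Hom (M N : Comod R C) where
  toLin : M.carrier →ₗ[Rᵐᵒᵖ] N.carrier
  map_coact : ∀ m, N.coact (toLin m) = Tensor.map R toLin LinearMap.id (M.coact m)

/-- The category `M^C` of counital right `C`-comodules. -/
instance : Category (Comod R C) where
  Hom := Hom
  id M := ⟨LinearMap.id, fun m => by
    exact Tensor.addHom_congr R (AddMonoidHom.id _) (Tensor.map R LinearMap.id LinearMap.id)
      (M.coact m) fun _ _ => rfl⟩
  comp f g := ⟨g.toLin.comp f.toLin, fun m => by
    rw [LinearMap.comp_apply, g.map_coact, f.map_coact]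
    exact Tensor.addHom_congr R ((Tensor.map R g.toLin LinearMap.id).comp
      (Tensor.map R f.toLin LinearMap.id)) (Tensor.map R (g.toLin.comp f.toLin) LinearMap.id) _
      fun _ _ => rfl⟩

variable (R C) in
/-- `C` as a right comodule over itself. -/
def regular : Comod R C where
  carrier := C
  coact := Coring.comul
  coassoc := Coring.coassoc
  counital c d h := by rw [← Coring.counit_right (R := R) c, h, Coring.counit_right]

end Comod

end Comodules

/-! ### Measuring pairings and rational modules -/

/-- The measuring pairing `(*C, C)`. -/
def selfPairing (R : Type u) (C : Type w) [Ring R] [AddCommGroup C] [Module R C] [Module Rᵐᵒᵖ C]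
    [SMulCommClass R Rᵐᵒᵖ C] [Coring R C] : RRingHom R (LeftDual R C) (LeftDual R C) :=
  RRingHom.id R (LeftDual R C)

section Pairing

variable {R : Type u} {A : Type v} {C : Type w} [Ring R]
  [NonUnitalRing A] [Module R A] [Module Rᵐᵒᵖ A]
  [AddCommGroup C] [Module R C] [Module Rᵐᵒᵖ C] [SMulCommClass R Rᵐᵒᵖ C] [Coring R C]

/-- The map `α_M : M ⊗_R C → Hom(A, M)`, `m ⊗ c ↦ [a ↦ m ⟨a, c⟩]`, where `⟨a, c⟩ = κ(a)(c)`. -/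
def alpha (κ : RRingHom R A (LeftDual R C)) {M : Type w₁} [AddCommGroup M] [Module Rᵐᵒᵖ M]
    (t : Tensor R M C) (a : A) : M :=
  Tensor.evalRight R (κ.toNonUnitalRingHom a).toLin t

theorem alpha_add (κ : RRingHom R A (LeftDual R C)) {M : Type w₁} [AddCommGroup M]
    [Module Rᵐᵒᵖ M] (t : Tensor R M C) (a b : A) : alpha κ t (a + b) = alpha κ t a + alpha κ t b := by
  unfold alpha
  rw [map_add, LeftDual.evalRight_add]

theorem add_alpha (κ : RRingHom R A (LeftDual R C)) {M : Type w₁} [AddCommGroup M]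
    [Module Rᵐᵒᵖ M] (s t : Tensor R M C) (a : A) : alpha κ (s + t) a = alpha κ s a + alpha κ t a :=
  map_add _ s t

theorem alpha_op_smul (κ : RRingHom R A (LeftDual R C)) {M : Type w₁} [AddCommGroup M]
    [Module Rᵐᵒᵖ M] (t : Tensor R M C) (a : A) (r : R) :
    alpha κ t (op r • a) = op r • alpha κ t a := by
  have h : κ.toNonUnitalRingHom (op r • a) = op r • κ.toNonUnitalRingHom a := κ.map_op_smul r a
  unfold alpha
  rw [h, LeftDual.evalRight_op_smul]

theorem op_smul_alpha (κ : RRingHom R A (LeftDual R C)) {M : Type w₁} [AddCommGroup M]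
    [Module Rᵐᵒᵖ M] (t : Tensor R M C) (a : A) (r : R) :
    alpha κ (op r • t) a = alpha κ t (r • a) := by
  have h : κ.toNonUnitalRingHom (r • a) = r • κ.toNonUnitalRingHom a := κ.map_smul r a
  unfold alpha
  rw [h, LeftDual.evalRight_smul]

/-- The right `A`-module of a counital comodule: `m a = ∑ m₀ ⟨a, m₁⟩`. -/
@[reducible] def Comod.toRightMod (κ : RRingHom R A (LeftDual R C)) (M : Comod R C) :
    RightMod.{u, v, w} R A where
  carrier := M.carrier
  act := AddMonoidHom.mk'
    (fun m => AddMonoidHom.mk' (fun a => alpha κ (M.coact m) a) (alpha_add κ _))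
    (fun m m' => AddMonoidHom.ext fun a =>
      (congrArg (fun t => alpha κ t a) (M.coact.map_add m m')).trans (add_alpha κ _ _ a))
  act_op_smul m a r := alpha_op_smul κ _ a r
  op_smul_act m a r :=
    (congrArg (fun t => alpha κ t a) (M.coact.map_smul (op r) m)).trans (op_smul_alpha κ _ a r)
  act_mul m a b := by
    change alpha κ (M.coact m) (a * b) = alpha κ (M.coact (alpha κ (M.coact m) a)) b
    unfold alpha
    rw [map_mul, LeftDual.evalRight_mul M.coact M.coassoc]

theorem Comod.Hom.map_alpha (κ : RRingHom R A (LeftDual R C)) {M N : Comod R C} (f : Comod.Hom M N)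
    (m : M.carrier) (a : A) :
    f.toLin (alpha κ (M.coact m) a) = alpha κ (N.coact (f.toLin m)) a := by
  rw [f.map_coact]
  exact (LeftDual.evalRight_map f.toLin _ _).symm

/-- The functor from counital comodules to right `A`-modules, `m a = ∑ m₀ ⟨a, m₁⟩`, which is the
identity on the underlying `R`-modules and on morphisms. -/
@[reducible] def comodToMod (κ : RRingHom R A (LeftDual R C)) : Comod R C ⥤ RightMod.{u, v, w} R A where
  obj M := M.toRightMod κ
  map f := ⟨f.toLin, f.map_alpha κ⟩

/-- `C` as a right `A`-module, `c ↼ a = ∑ c₁ ⟨a, c₂⟩`. -/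
def coringMod (κ : RRingHom R A (LeftDual R C)) : RightMod.{u, v, w} R A :=
  (comodToMod κ).obj (Comod.regular R C)

/-- `Rat^C(M)`: the `m ∈ M` for which there is `∑ mᵢ ⊗ cᵢ ∈ M ⊗_R C` with
`m a = ∑ mᵢ ⟨a, cᵢ⟩` for all `a`. -/
def ratPart (κ : RRingHom R A (LeftDual R C)) (M : RightMod.{u, v, w} R A) : Set M.carrier :=
  {m | ∃ t : Tensor R M.carrier C, ∀ a, M.act m a = alpha κ t a}

/-- The full subcategory of the `A`-faithful right `A`-modules `M` that are `C`-rational, i.e.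
`Rat^C(M) = M`. -/
def ratFaithful (κ : RRingHom R A (LeftDual R C)) : ObjectProperty (RightMod.{u, v, w} R A) :=
  fun M => M.IsFaithful ∧ ratPart κ M = Set.univ

/-- The full subcategory of the unital right `A`-modules `M` that are `C`-rational, i.e.
`Rat^C(M) = M`. -/
def ratUnital (κ : RRingHom R A (LeftDual R C)) : ObjectProperty (RightMod.{u, v, w} R A) :=
  fun M => M.IsUnital ∧ ratPart κ M = Set.univ

end Pairing

/-- `F` is an isomorphism of categories (not just an equivalence). -/
def IsCatIso {𝒞 : Type w₁} {𝒟 : Type w₂} [Category.{w₃} 𝒞] [Category.{w₄} 𝒟] (F : 𝒞 ⥤ 𝒟) : Prop :=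
  ∃ G : 𝒟 ⥤ 𝒞, F ⋙ G = 𝟭 𝒞 ∧ G ⋙ F = 𝟭 𝒟

end

end CoringPairing

namespace CoringPairing

/-! ### Finite determination of tensors, dual bases and density -/

section Local

variable {R : Type u} {C : Type w} [Ring R] [AddCommGroup C] [Module R C]
  {M : Type w₁} [AddCommGroup M] [Module Rᵐᵒᵖ M]

/-! Everything rests on one separation property: for every right `R`-module `M`, an element `t` of
`M ⊗ C` is determined by the values `alpha κ t a` (`IsDensePairing.alpha_injective`). Local
projectivity supplies finitely many `x` and functionals `f x` with `t = ∑ t(f x) ⊗ x`. Since `t(f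
x)` depends on only finitely many values of `f x`, density replaces `f x` by the image of some `a x`
in `A`.

Hence a rational element `m` has exactly one representing tensor, and `m ↦` this tensor is a right
linear map `M → M ⊗ C`. Coassociativity is the identity `(m a) b = m (a b)`, read off by applying
separation twice; injectivity of the coaction is faithfulness. Colinear and `A`-linear maps agree
for the same reason. This makes `comodToMod` bijective on objects and fully faithful.

Faithful and unital rational modules agree by density alone: the counit is a two-sided unit of `*C`,
so elements of `A` close to it act as local units.

For `σ[C]`, the coaction embeds `M` into `M ⊗ C`, a quotient of a direct sum of copies of `C`.
Conversely, `C` is rational, and rationality passes to direct sums, quotients and, by the finite sum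
formula, submodules.

The identity of `*C` is trivially dense, so all of this applies to `*C`. Restriction along `κ`
composed with the isomorphism for `*C` is the one for `A` on objects, so it is bijective there too.
-/

theorem Tensor.zero_tmul (c : C) : Tensor.tmul R (0 : M) c = 0 :=
  DFunLike.congr_fun (map_zero (Tensor.mk R)) c

theorem Tensor.tmul_sum {ι : Type*} (s : Finset ι) (m : M) (c : ι → C) :
    Tensor.tmul R m (∑ i ∈ s, c i) = ∑ i ∈ s, Tensor.tmul R m (c i) :=
  map_sum (Tensor.mk R m) c s

/-- The value of `id ⊗ f` at a given tensor depends on finitely many values of `f`. -/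
theorem exists_finset_evalRight_congr (t : Tensor R M C) :
    ∃ F : Finset C, ∀ f g : LeftDual R C, (∀ c ∈ F, f c = g c) →
      Tensor.evalRight R f.toLin t = Tensor.evalRight R g.toLin t := by
  classical
  induction t using Tensor.induction with
  | tmul m c => exact ⟨{c}, fun f g h => by simp [h c (by simp)]⟩
  | zero => exact ⟨∅, fun f g _ => by simp⟩
  | add x y hx hy =>
    obtain ⟨F, hF⟩ := hx
    obtain ⟨G, hG⟩ := hy
    refine ⟨F ∪ G, fun f g h => ?_⟩
    rw [map_add, map_add, hF f g fun c hc => h c (Finset.mem_union_left _ hc),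
      hG f g fun c hc => h c (Finset.mem_union_right _ hc)]

/-- Expanding the second factors of `t` in a dual basis and moving the coefficients across the
tensor sign reconstructs `t` from its evaluations. Here `F` collects the second factors of a
presentation of `t`, and must be fixed before the dual basis is chosen. -/
theorem exists_finset_eq_sum (t : Tensor R M C) :
    ∃ F : Finset C, ∀ (S : Finset C) (f : C → LeftDual R C),
      (∀ c ∈ F, c = ∑ x ∈ S, f x c • x) →
      t = ∑ x ∈ S, Tensor.tmul R (Tensor.evalRight R (f x).toLin t) x := by
  classical
  induction t using Tensor.induction with
  | tmul m c =>
    refine ⟨{c}, fun S f h => ?_⟩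
    conv_lhs => rw [h c (by simp), Tensor.tmul_sum]
    exact Finset.sum_congr rfl fun x _ => (Tensor.smul_tmul R m (f x c) x).symm
  | zero => exact ⟨∅, fun S f _ => by simp [Tensor.zero_tmul]⟩
  | add x y hx hy =>
    obtain ⟨F, hF⟩ := hx
    obtain ⟨G, hG⟩ := hy
    refine ⟨F ∪ G, fun S f h => ?_⟩
    simp only [map_add, Tensor.add_tmul, Finset.sum_add_distrib]
    rw [← hF S f fun c hc => h c (Finset.mem_union_left _ hc),
      ← hG S f fun c hc => h c (Finset.mem_union_right _ hc)]

/-- The dual basis property of locally projective modules. -/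
theorem IsLocallyProjective.exists_dual_basis (hC : IsLocallyProjective R C) (F : Finset C) :
    ∃ (S : Finset C) (f : C → LeftDual R C), ∀ c ∈ F, c = ∑ x ∈ S, f x c • x := by
  classical
  -- Lift the identity of `C` along the canonical surjection from the free module on the set `C`;
  -- `ULift` only moves the target to the universe of the definition. The coordinates of the lift
  -- are the required functionals.
  obtain ⟨g, hg⟩ := hC (C →₀ R) (ULift.{max u w} C)
    (ULift.moduleEquiv.symm.toLinearMap ∘ₗ Finsupp.linearCombination R (id : C → C))
    ULift.moduleEquiv.symm.toLinearMap (Submodule.span R (F : Set C))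
    (fun y => by
      refine ⟨Finsupp.single y.down 1, ?_⟩
      ext
      simp)
    ⟨F, rfl⟩
  refine ⟨F.biUnion fun c => (g c).support, fun x => (Finsupp.lapply x : (C →₀ R) →ₗ[R] R) ∘ₗ g,
    fun c hc => ?_⟩
  have h : Finsupp.linearCombination R (id : C → C) (g c) = c :=
    ULift.moduleEquiv.symm.injective (hg c (Submodule.subset_span hc))
  conv_lhs => rw [← h, Finsupp.linearCombination_apply]
  exact Finsupp.sum_of_support_subset _
    (Finset.subset_biUnion_of_mem (fun c => (g c).support) hc) _ (by simp)

/-- The functionals agreeing with `f` on `F` form a basic open neighbourhood of `f`, because `R` is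
discrete. -/
theorem exists_eq_of_dense {s : Set (LeftDual R C)}
    (hs : @Dense (LeftDual R C) (finiteTopology R C) s) (f : LeftDual R C) (F : Finset C) :
    ∃ g ∈ s, ∀ c ∈ F, g c = f c := by
  let : TopologicalSpace R := ⊥
  let : TopologicalSpace (LeftDual R C) := finiteTopology R C
  have : DiscreteTopology R := ⟨rfl⟩
  have ho : IsOpen {g : LeftDual R C | ∀ c ∈ F, g c = f c} :=
    isOpen_induced_iff.2 ⟨Set.pi (F : Set C) fun c => {f c},
      isOpen_set_pi F.finite_toSet fun c _ => isOpen_discrete _, by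
        ext g; simp [Set.mem_pi]⟩
  obtain ⟨g, hg, hgs⟩ := hs.inter_open_nonempty _ ho ⟨f, fun _ _ => rfl⟩
  exact ⟨g, hgs, hg⟩

end Local

/-! ### Iterated evaluation on `C ⊗ C` -/

section PairEval

variable {R : Type u} {C : Type w} [Ring R] [AddCommGroup C] [Module R C] [Module Rᵐᵒᵖ C]
  [SMulCommClass R Rᵐᵒᵖ C]

/-- The left linear map `c ⊗ d ↦ g(c f(d))`. -/
def pairEval (f g : LeftDual R C) : Tensor R C C →ₗ[R] R where
  toFun t := g (Tensor.evalRight R f.toLin t)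
  map_add' s t := by simp
  map_smul' r t := by simp [Tensor.evalRight_left_smul]

theorem evalRight_pairEval_assoc {M : Type w₁} [AddCommGroup M] [Module Rᵐᵒᵖ M]
    (f g : LeftDual R C) (t : Tensor R (Tensor R M C) C) :
    Tensor.evalRight R (pairEval f g) (Tensor.assoc R t) =
      Tensor.evalRight R g.toLin (Tensor.evalRight R f.toLin t) := by
  refine Tensor.addHom_congr R ((Tensor.evalRight R (pairEval f g)).comp (Tensor.assoc R))
    ((Tensor.evalRight R g.toLin).comp (Tensor.evalRight R f.toLin)) t fun s c => ?_
  simp only [AddMonoidHom.comp_apply]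
  induction s using Tensor.induction with
  | tmul m n => simp [pairEval]
  | zero => simp only [Tensor.zero_tmul, map_zero]
  | add x y hx hy => rw [Tensor.add_tmul]; simp only [map_add, hx, hy]

end PairEval

/-! ### The counit as a unit of the left dual -/

section Counit

variable (R : Type u) (C : Type w) [Ring R] [AddCommGroup C] [Module R C] [Module Rᵐᵒᵖ C]
  [SMulCommClass R Rᵐᵒᵖ C] [Coring R C]

/-- The counit as an element of `*C`. -/
def counitDual : LeftDual R C := (Coring.counit : C →ₗ[R] R)

variable {R C}

theorem evalRight_counitDual_comul (c : C) :
    Tensor.evalRight R (counitDual R C).toLin (Coring.comul c) = c :=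
  Coring.counit_right c

/-- `ε(c₁ f(c₂)) = ε(c₁) f(c₂) = f(ε(c₁) c₂) = f(c)`, by right linearity of `ε`, left linearity of
`f` and the left counit law. -/
theorem mul_counitDual (f : LeftDual R C) : f * counitDual R C = f := by
  ext c
  rw [LeftDual.mul_apply]
  conv_rhs => rw [← Coring.counit_left (R := R) c]
  generalize (Coring.comul c : Tensor R C C) = t
  exact Tensor.addHom_congr R
    ((counitDual R C).toLin.toAddMonoidHom.comp (Tensor.evalRight R f.toLin))
    (f.toLin.toAddMonoidHom.comp (Tensor.evalLeft R _)) t fun x y =>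
      (Coring.counit_op_smul (f y) x).trans (f.map_smul' (Coring.counit x) y).symm

end Counit

/-! ### Dense pairings: separation and local units -/

section Pairing

variable {R : Type u} {A : Type v} {C : Type w} [Ring R]
  [NonUnitalRing A] [Module R A] [Module Rᵐᵒᵖ A]
  [AddCommGroup C] [Module R C] [Module Rᵐᵒᵖ C] [SMulCommClass R Rᵐᵒᵖ C] [Coring R C]

/-- Every element of `*C` agrees on every finite set with an element of the image of `κ`. -/
def IsDensePairing (κ : RRingHom R A (LeftDual R C)) : Prop :=
  ∀ (f : LeftDual R C) (F : Finset C), ∃ a, ∀ c ∈ F, κ.toNonUnitalRingHom a c = f c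

theorem isDensePairing_selfPairing : IsDensePairing (selfPairing R C) :=
  fun f _ => ⟨f, fun _ _ => rfl⟩

variable {κ : RRingHom R A (LeftDual R C)}

/-- The reconstruction formula with coefficients in `A` instead of `*C`. Replacing `f x` by `a x` is
harmless because the two agree on the finite set `G` that controls evaluation at `t`. -/
theorem IsDensePairing.exists_eq_sum {M : Type w₁} [AddCommGroup M] [Module Rᵐᵒᵖ M]
    (hκ : IsDensePairing κ) (hC : IsLocallyProjective R C) (t : Tensor R M C) :
    ∃ (S : Finset C) (a : C → A), t = ∑ x ∈ S, Tensor.tmul R (alpha κ t (a x)) x := by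
  obtain ⟨F, hF⟩ := exists_finset_eq_sum t
  obtain ⟨G, hG⟩ := exists_finset_evalRight_congr t
  obtain ⟨S, f, hf⟩ := hC.exists_dual_basis F
  choose a ha using fun x => hκ (f x) G
  refine ⟨S, a, (hF S f hf).trans (Finset.sum_congr rfl fun x _ => ?_)⟩
  rw [alpha, hG _ _ (ha x)]

/-- The reconstruction formula for `s - t` has all coefficients zero. -/
theorem IsDensePairing.alpha_injective {M : Type w₁} [AddCommGroup M] [Module Rᵐᵒᵖ M]
    (hκ : IsDensePairing κ) (hC : IsLocallyProjective R C) {s t : Tensor R M C}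
    (h : ∀ a, alpha κ s a = alpha κ t a) : s = t := by
  obtain ⟨S, a, ha⟩ := hκ.exists_eq_sum hC (s - t)
  rw [← sub_eq_zero, ha]
  refine Finset.sum_eq_zero fun x _ => ?_
  have h0 : alpha κ (s - t) (a x) = 0 :=
    (map_sub (Tensor.evalRight R (κ.toNonUnitalRingHom (a x)).toLin) s t).trans
      (sub_eq_zero.2 (h _))
  rw [h0, Tensor.zero_tmul]

theorem alpha_zero_right {M : Type w₁} [AddCommGroup M] [Module Rᵐᵒᵖ M] (a : A) :
    alpha κ (0 : Tensor R M C) a = 0 := map_zero _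

theorem alpha_map {M : Type w₁} {N : Type w₂} [AddCommGroup M] [Module Rᵐᵒᵖ M]
    [AddCommGroup N] [Module Rᵐᵒᵖ N] (φ : M →ₗ[Rᵐᵒᵖ] N) (t : Tensor R M C) (a : A) :
    alpha κ (Tensor.map R φ LinearMap.id t) a = φ (alpha κ t a) :=
  LeftDual.evalRight_map φ _ t

/-- The product of `*C` is composition with `c ↦ c ↼ a`. This is what makes the coaction `A`-linear
as a map into `M ⊗ C`. -/
theorem alpha_map_act {M : Type w₁} [AddCommGroup M] [Module Rᵐᵒᵖ M] (t : Tensor R M C)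
    (a b : A) :
    alpha κ (Tensor.map R LinearMap.id (κ.toNonUnitalRingHom a).act t) b = alpha κ t (a * b) := by
  unfold alpha
  rw [map_mul]
  exact Tensor.addHom_congr R ((Tensor.evalRight R (κ.toNonUnitalRingHom b).toLin).comp
    (Tensor.map R LinearMap.id (κ.toNonUnitalRingHom a).act)) (Tensor.evalRight R _) t
    fun _ _ => rfl

/-- Local left units: every `t` has an `a` with `t (a b) = t b` for all `b`. -/
theorem IsDensePairing.exists_alpha_mul_eq {M : Type w₁} [AddCommGroup M] [Module Rᵐᵒᵖ M]
    (hκ : IsDensePairing κ) (t : Tensor R M C) :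
    ∃ a, ∀ b, alpha κ t (a * b) = alpha κ t b := by
  classical
  obtain ⟨F, hF⟩ := exists_finset_evalRight_congr t
  choose G hG using fun c : C => exists_finset_evalRight_congr (Coring.comul c : Tensor R C C)
  obtain ⟨a, ha⟩ := hκ (counitDual R C) (F.biUnion G)
  -- Since `(a b)(c) = b(c ↼ a)`, it suffices that `c ↼ a = c` for `c` in `F`; this holds once `a`
  -- agrees with `ε` on the finite sets controlling `Δ(c)`.
  refine ⟨a, fun b => hF _ _ fun c hc => ?_⟩
  rw [map_mul, LeftDual.mul_apply, hG c _ (counitDual R C)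
    fun d hd => ha d (Finset.mem_biUnion.2 ⟨c, hc, hd⟩), evalRight_counitDual_comul]

/-- Local right units: an element `b` that is close to the counit satisfies `t (a b) = t a`. -/
theorem exists_finset_alpha_mul_eq {M : Type w₁} [AddCommGroup M] [Module Rᵐᵒᵖ M]
    (κ : RRingHom R A (LeftDual R C)) (t : Tensor R M C) (a : A) :
    ∃ F : Finset C, ∀ b, (∀ c ∈ F, κ.toNonUnitalRingHom b c = counitDual R C c) →
      alpha κ t (a * b) = alpha κ t a := by
  classical
  obtain ⟨F, hF⟩ := exists_finset_evalRight_congr t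
  -- The points `c ↼ a` for `c` in `F`, at which `b` is evaluated: there `b(c ↼ a) = ε(c ↼ a) = (a ⋆
  -- ε)(c) = a(c)`.
  refine ⟨F.image fun c => Tensor.evalRight R (κ.toNonUnitalRingHom a).toLin (Coring.comul c),
    fun b hb => hF _ _ fun c hc => ?_⟩
  rw [map_mul, LeftDual.mul_apply, hb _ (Finset.mem_image_of_mem _ hc), ← LeftDual.mul_apply,
    mul_counitDual]

/-! ### Rational modules -/

theorem rat_eq_univ_iff {M : RightMod.{u, v, w} R A} :
    ratPart κ M = Set.univ ↔ ∀ m, ∃ t : Tensor R M.carrier C, ∀ a, M.act m a = alpha κ t a :=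
  Set.eq_univ_iff_forall

theorem RightMod.isFaithful_iff {M : RightMod.{u, v, w} R A} :
    M.IsFaithful ↔ ∀ m, (∀ a, M.act m a = 0) → m = 0 := by
  refine ⟨fun h m hm => h (funext fun a => by simp [hm]), fun h m n hmn => ?_⟩
  refine sub_eq_zero.1 (h _ fun a => ?_)
  rw [map_sub, AddMonoidHom.sub_apply, sub_eq_zero]
  exact congrFun hmn a

/-- A local left unit `a` for the tensor of `m` gives `(m a) b = m b` for all `b`, so faithfulness
forces `m = m a`. -/
theorem IsDensePairing.isUnital_of_isFaithful (hκ : IsDensePairing κ)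
    {M : RightMod.{u, v, w} R A} (hM : ratFaithful κ M) : M.IsUnital := by
  refine eq_top_iff.2 fun m _ => AddSubgroup.subset_closure ?_
  obtain ⟨t, ht⟩ := rat_eq_univ_iff.1 hM.2 m
  obtain ⟨a, ha⟩ := hκ.exists_alpha_mul_eq t
  refine ⟨m, a, hM.1 (funext fun b => ?_)⟩
  change M.act m b = M.act (M.act m a) b
  rw [← M.act_mul, ht, ht, ha]

theorem IsDensePairing.isFaithful_of_isUnital (hκ : IsDensePairing κ)
    {M : RightMod.{u, v, w} R A} (hM : ratUnital κ M) : M.IsFaithful := by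
  classical
  -- Asking that all `b` close enough to the counit fix `m`, rather than a single `b`, makes the
  -- claim stable under sums: take the union of the finite sets.
  have key : ∀ m : M.carrier, ∃ F : Finset C, ∀ b,
      (∀ c ∈ F, κ.toNonUnitalRingHom b c = counitDual R C c) → M.act m b = m := by
    intro m
    have hm : m ∈ AddSubgroup.closure {x : M.carrier | ∃ m a, x = M.act m a} := by
      rw [hM.1]; trivial
    induction hm using AddSubgroup.closure_induction with
    | mem x hx =>
      obtain ⟨n, a, rfl⟩ := hx
      obtain ⟨t, ht⟩ := rat_eq_univ_iff.1 hM.2 n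
      obtain ⟨F, hF⟩ := exists_finset_alpha_mul_eq κ t a
      exact ⟨F, fun b hb => by rw [← M.act_mul, ht, ht, hF b hb]⟩
    | zero => exact ⟨∅, fun b _ => by simp⟩
    | add x y _ _ hx hy =>
      obtain ⟨F, hF⟩ := hx
      obtain ⟨G, hG⟩ := hy
      refine ⟨F ∪ G, fun b hb => ?_⟩
      rw [map_add, AddMonoidHom.add_apply, hF b fun c hc => hb c (Finset.mem_union_left _ hc),
        hG b fun c hc => hb c (Finset.mem_union_right _ hc)]
    | neg x _ hx =>
      obtain ⟨F, hF⟩ := hx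
      exact ⟨F, fun b hb => by rw [map_neg, AddMonoidHom.neg_apply, hF b hb]⟩
  refine RightMod.isFaithful_iff.2 fun m hm => ?_
  obtain ⟨F, hF⟩ := key m
  obtain ⟨b, hb⟩ := hκ (counitDual R C) F
  rw [← hF b hb, hm]

theorem IsDensePairing.ratFaithful_eq_ratUnital (hκ : IsDensePairing κ) :
    ratFaithful κ = (ratUnital κ : ObjectProperty (RightMod.{u, v, w} R A)) := by
  ext M
  exact ⟨fun h => ⟨hκ.isUnital_of_isFaithful h, h.2⟩,
    fun h => ⟨hκ.isFaithful_of_isUnital h, h.2⟩⟩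

theorem rat_of_surjective {M N : RightMod.{u, v, w} R A} (p : M ⟶ N)
    (hp : Function.Surjective (RightMod.Hom.toLin p)) (hM : ratPart κ M = Set.univ) :
    ratPart κ N = Set.univ := by
  refine rat_eq_univ_iff.2 fun n => ?_
  obtain ⟨m, rfl⟩ := hp n
  obtain ⟨t, ht⟩ := rat_eq_univ_iff.1 hM m
  exact ⟨Tensor.map R p.toLin LinearMap.id t, fun a => by rw [alpha_map, ← ht, p.map_act]⟩

/-- In `t = ∑ t(a x) ⊗ x` the coefficients are `i(n) (a x) = i(n (a x))`, so a tensor representing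
`i(n)` over `M` already comes from `N ⊗ C`. -/
theorem IsDensePairing.rat_of_injective (hκ : IsDensePairing κ) (hC : IsLocallyProjective R C)
    {M N : RightMod.{u, v, w} R A} (i : N ⟶ M)
    (hi : Function.Injective (RightMod.Hom.toLin i)) (hM : ratPart κ M = Set.univ) :
    ratPart κ N = Set.univ := by
  refine rat_eq_univ_iff.2 fun n => ?_
  obtain ⟨t, ht⟩ := rat_eq_univ_iff.1 hM (i.toLin n)
  obtain ⟨S, a, hS⟩ := hκ.exists_eq_sum hC t
  have h : t = Tensor.map R i.toLin LinearMap.id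
      (∑ x ∈ S, Tensor.tmul R (N.act n (a x)) x) := by
    rw [map_sum]
    refine hS.trans (Finset.sum_congr rfl fun x _ => ?_)
    rw [Tensor.map_tmul, i.map_act, ht]
    rfl
  refine ⟨∑ x ∈ S, Tensor.tmul R (N.act n (a x)) x, fun b => hi ?_⟩
  rw [i.map_act, ht, ← alpha_map, ← h]

theorem rat_directSum {K : RightMod.{u, v, w} R A} (hK : ratPart κ K = Set.univ) (Λ : Type w) :
    ratPart κ (K.directSum Λ) = Set.univ := by
  classical
  refine rat_eq_univ_iff.2 fun (x : Λ →₀ K.carrier) => ?_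
  induction x using Finsupp.induction_linear with
  | zero => exact ⟨0, fun a =>
      (DFunLike.congr_fun (map_zero (K.directSum Λ).act) a).trans (alpha_zero_right a).symm⟩
  | add x y hx hy =>
    obtain ⟨s, hs⟩ := hx
    obtain ⟨t, ht⟩ := hy
    exact ⟨s + t, fun a => by
      rw [add_alpha, ← hs, ← ht]
      exact DFunLike.congr_fun (map_add (K.directSum Λ).act x y) a⟩
  | single i k =>
    obtain ⟨t, ht⟩ := rat_eq_univ_iff.1 hK k
    refine ⟨Tensor.map R (Finsupp.lsingle i : K.carrier →ₗ[Rᵐᵒᵖ] Λ →₀ K.carrier)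
      LinearMap.id t, fun a => ?_⟩
    refine Eq.trans ?_ (alpha_map _ t a).symm
    rw [← ht]
    exact Finsupp.mapRange_single (hf := by simp)

theorem rat_coringMod (κ : RRingHom R A (LeftDual R C)) :
    ratPart κ (coringMod κ) = Set.univ :=
  rat_eq_univ_iff.2 fun c => ⟨Coring.comul (R := R) (C := C) c, fun _ => rfl⟩

/-! ### The coaction of a rational module -/

/-- The coaction of a rational module: `coact m` represents `a ↦ m a`. -/
noncomputable def ratCoact (hκ : IsDensePairing κ) (hC : IsLocallyProjective R C)
    {M : RightMod.{u, v, w} R A} (hM : ratPart κ M = Set.univ) :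
    M.carrier →ₗ[Rᵐᵒᵖ] Tensor R M.carrier C where
  toFun m := (rat_eq_univ_iff.1 hM m).choose
  map_add' m n := hκ.alpha_injective hC fun a => by
    rw [add_alpha, ← (rat_eq_univ_iff.1 hM (m + n)).choose_spec,
      ← (rat_eq_univ_iff.1 hM m).choose_spec, ← (rat_eq_univ_iff.1 hM n).choose_spec, map_add]
    rfl
  map_smul' r m := hκ.alpha_injective hC fun a => by
    have h := op_smul_alpha κ (rat_eq_univ_iff.1 hM m).choose a r.unop
    rw [op_unop] at h
    rw [RingHom.id_apply, h, ← (rat_eq_univ_iff.1 hM (r • m)).choose_spec,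
      ← (rat_eq_univ_iff.1 hM m).choose_spec, ← M.op_smul_act, op_unop]

theorem alpha_ratCoact (hκ : IsDensePairing κ) (hC : IsLocallyProjective R C)
    {M : RightMod.{u, v, w} R A} (hM : ratPart κ M = Set.univ) (m : M.carrier) (a : A) :
    alpha κ (ratCoact hκ hC hM m) a = M.act m a :=
  ((rat_eq_univ_iff.1 hM m).choose_spec a).symm

theorem ratCoact_injective (hκ : IsDensePairing κ) (hC : IsLocallyProjective R C)
    {M : RightMod.{u, v, w} R A} (hM : ratFaithful κ M) :
    Function.Injective (ratCoact hκ hC hM.2) := fun m n h => hM.1 <| funext fun a => by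
  change M.act m a = M.act n a
  rw [← alpha_ratCoact hκ hC hM.2, h, alpha_ratCoact]

theorem Tensor.assoc_surjective {M : Type w₁} {N : Type w₂} {P : Type w₃} [AddCommGroup M]
    [Module Rᵐᵒᵖ M] [AddCommGroup N] [Module R N] [Module Rᵐᵒᵖ N] [SMulCommClass R Rᵐᵒᵖ N]
    [AddCommGroup P] [Module R P] :
    Function.Surjective (Tensor.assoc R (M := M) (N := N) (P := P)) := by
  intro t
  induction t using Tensor.induction with
  | tmul m s =>
    induction s using Tensor.induction with
    | tmul n p => exact ⟨_, Tensor.assoc_tmul R m n p⟩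
    | zero => exact ⟨0, (map_zero _).trans (map_zero (Tensor.mk R m)).symm⟩
    | add x y hx hy =>
      obtain ⟨a, ha⟩ := hx
      obtain ⟨b, hb⟩ := hy
      exact ⟨a + b, by rw [map_add, ha, hb, Tensor.tmul_add]⟩
  | zero => exact ⟨0, map_zero _⟩
  | add x y hx hy =>
    obtain ⟨a, ha⟩ := hx
    obtain ⟨b, hb⟩ := hy
    exact ⟨a + b, by rw [map_add, ha, hb]⟩

theorem evalRight_pairEval_comul {M : Type w₁} [AddCommGroup M] [Module Rᵐᵒᵖ M]
    (f g : LeftDual R C) (t : Tensor R M C) :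
    Tensor.evalRight R (pairEval f g) (Tensor.map R LinearMap.id (comulLeft R C) t) =
      Tensor.evalRight R (f * g).toLin t :=
  Tensor.addHom_congr R ((Tensor.evalRight R (pairEval f g)).comp
    (Tensor.map R LinearMap.id (comulLeft R C))) (Tensor.evalRight R (f * g).toLin) t
    fun _ _ => rfl

/-- The maps `c ⊗ d ↦ ⟨b, c ⟨a, d⟩⟩` separate the elements of `M ⊗ (C ⊗ C)`. -/
theorem IsDensePairing.evalRight_pairEval_injective {M : Type w₁} [AddCommGroup M]
    [Module Rᵐᵒᵖ M] (hκ : IsDensePairing κ) (hC : IsLocallyProjective R C)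
    {s t : Tensor R M (Tensor R C C)}
    (h : ∀ a b, Tensor.evalRight R
        (pairEval (κ.toNonUnitalRingHom a) (κ.toNonUnitalRingHom b)) s =
      Tensor.evalRight R (pairEval (κ.toNonUnitalRingHom a) (κ.toNonUnitalRingHom b)) t) :
    s = t := by
  obtain ⟨s, rfl⟩ := Tensor.assoc_surjective s
  obtain ⟨t, rfl⟩ := Tensor.assoc_surjective t
  -- Separation is applied first with coefficients in the right module `M ⊗ C`, then with
  -- coefficients in `M`.
  refine congrArg _ (hκ.alpha_injective hC fun a => hκ.alpha_injective hC fun b => ?_)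
  have := h a b
  rwa [evalRight_pairEval_assoc, evalRight_pairEval_assoc] at this

/-- Evaluated at `a` and `b`, the two sides become `(m a) b` and `m (a b)`. -/
theorem ratCoact_coassoc (hκ : IsDensePairing κ) (hC : IsLocallyProjective R C)
    {M : RightMod.{u, v, w} R A} (hM : ratPart κ M = Set.univ) (m : M.carrier) :
    Tensor.assoc R (Tensor.map R (ratCoact hκ hC hM) LinearMap.id (ratCoact hκ hC hM m)) =
      Tensor.map R LinearMap.id (comulLeft R C) (ratCoact hκ hC hM m) := by
  refine hκ.evalRight_pairEval_injective hC fun a b => ?_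
  rw [evalRight_pairEval_assoc, evalRight_pairEval_comul, ← map_mul]
  change alpha κ (alpha κ (Tensor.map R (ratCoact hκ hC hM) LinearMap.id _) a) b = alpha κ _ (a * b)
  rw [alpha_map, alpha_ratCoact, alpha_ratCoact, alpha_ratCoact, M.act_mul]

/-- The comodule of a rational faithful module. -/
@[reducible] noncomputable def ratComod (hκ : IsDensePairing κ) (hC : IsLocallyProjective R C)
    {M : RightMod.{u, v, w} R A} (hM : ratFaithful κ M) : Comod R C where
  carrier := M.carrier
  coact := ratCoact hκ hC hM.2
  coassoc := ratCoact_coassoc hκ hC hM.2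
  counital := ratCoact_injective hκ hC hM

/-! ### Rational modules are subgenerated by the coring -/

/-- `M ⊗_R C` as a right `A`-module, `(m ⊗ c) a = m ⊗ (c ↼ a)`. -/
def tensorMod (κ : RRingHom R A (LeftDual R C)) (M : Type w) [AddCommGroup M] [Module Rᵐᵒᵖ M] :
    RightMod.{u, v, w} R A where
  carrier := Tensor R M C
  act := AddMonoidHom.flip (AddMonoidHom.mk'
    (fun a => Tensor.map R LinearMap.id (κ.toNonUnitalRingHom a).act)
    (fun a b => Tensor.addHom_ext R fun m c => by
      rw [AddMonoidHom.add_apply, Tensor.map_tmul, Tensor.map_tmul, Tensor.map_tmul,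
        ← Tensor.tmul_add, map_add]
      exact congrArg _ (LeftDual.evalRight_add _ _ _)))
  act_op_smul t a r := by
    refine Tensor.addHom_congr R (Tensor.map R LinearMap.id (κ.toNonUnitalRingHom (op r • a)).act)
      ((Tensor.rsmul R (op r)).comp (Tensor.map R LinearMap.id (κ.toNonUnitalRingHom a).act)) t
      fun m c => congrArg (Tensor.tmul R m) ((coringMod κ).act_op_smul c a r)
  op_smul_act t a r := by
    refine Tensor.addHom_congr R
      ((Tensor.map R LinearMap.id (κ.toNonUnitalRingHom a).act).comp (Tensor.rsmul R (op r)))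
      (Tensor.map R LinearMap.id (κ.toNonUnitalRingHom (r • a)).act) t
      fun m c => congrArg (Tensor.tmul R m) ((coringMod κ).op_smul_act c a r)
  act_mul t a b := by
    refine Tensor.addHom_congr R (Tensor.map R LinearMap.id (κ.toNonUnitalRingHom (a * b)).act)
      ((Tensor.map R LinearMap.id (κ.toNonUnitalRingHom b).act).comp
        (Tensor.map R LinearMap.id (κ.toNonUnitalRingHom a).act)) t
      fun m c => congrArg (Tensor.tmul R m) ((coringMod κ).act_mul c a b)

/-- One copy of `C` for each `m` in `M`, mapped by `c ↦ m ⊗ c`. -/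
theorem isGenerated_tensorMod (κ : RRingHom R A (LeftDual R C)) (M : Type w) [AddCommGroup M]
    [Module Rᵐᵒᵖ M] : (coringMod κ).IsGenerated (tensorMod κ M) := by
  let p : (M →₀ C) →ₗ[Rᵐᵒᵖ] Tensor R M C :=
    Finsupp.lsum ℕ fun m => { Tensor.mk R m with map_smul' := fun _ _ => rfl }
  have hp : ∀ (m : M) (c : C), p (Finsupp.single m c) = Tensor.tmul R m c := fun m c =>
    Finsupp.sum_single_index (map_zero (Tensor.mk R m))
  have key : ∀ a, p.toAddMonoidHom.comp
      (show (M →₀ C) →+ (M →₀ C) from ((coringMod κ).directSum M).act.flip a) =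
      (show Tensor R M C →+ Tensor R M C from (tensorMod κ M).act.flip a).comp
        p.toAddMonoidHom := fun a => Finsupp.addHom_ext fun m c => by
    have h : ((coringMod κ).directSum M).act (Finsupp.single m c) a =
      Finsupp.single m ((coringMod κ).act c a) := Finsupp.mapRange_single (hf := by simp)
    exact (congrArg p h).trans ((hp _ _).trans
      (congrArg (fun z => (tensorMod κ M).act z a) (hp m c).symm))
  refine ⟨M, ⟨p, fun x a => DFunLike.congr_fun (key a) x⟩, fun t => ?_⟩
  · induction t using Tensor.induction with
    | tmul m c => exact ⟨Finsupp.single m c, hp m c⟩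
    | zero => exact ⟨0, map_zero _⟩
    | add x y hx hy =>
      obtain ⟨a, ha⟩ := hx
      obtain ⟨b, hb⟩ := hy
      exact ⟨a + b, (map_add p a b).trans (congrArg₂ _ ha hb)⟩

theorem IsDensePairing.ratUnital_eq_sigma (hκ : IsDensePairing κ)
    (hC : IsLocallyProjective R C) : ratUnital κ = (coringMod κ).sigma := by
  ext M
  refine ⟨fun h => ⟨h.1, tensorMod κ M.carrier, ⟨ratCoact hκ hC h.2, fun m a => ?_⟩,
    isGenerated_tensorMod κ M.carrier,
    ratCoact_injective hκ hC ⟨hκ.isFaithful_of_isUnital h, h.2⟩⟩, ?_⟩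
  -- `A`-linearity of the coaction: both sides take the value `m (a b)` at `b`.
  · refine hκ.alpha_injective hC fun b => ?_
    refine Eq.trans ?_ (alpha_map_act (ratCoact hκ hC h.2 m) a b).symm
    exact (alpha_ratCoact hκ hC h.2 _ b).trans
      ((M.act_mul m a b).symm.trans (alpha_ratCoact hκ hC h.2 m _).symm)
  · rintro ⟨h, G, i, ⟨Λ, p, hp⟩, hi⟩
    exact ⟨h, hκ.rat_of_injective hC i hi
      (rat_of_surjective p hp (rat_directSum (rat_coringMod κ) Λ))⟩

/-! ### Isomorphisms of categories -/

/-- The inverse functor takes preimages of morphisms after transport along the object equalities `F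
(g X) = X`; the functor laws follow from faithfulness. -/
theorem IsCatIso.of_bijective {𝒞 : Type w₁} {𝒟 : Type w₂} [Category.{w₃} 𝒞] [Category.{w₄} 𝒟]
    (F : 𝒞 ⥤ 𝒟) [F.Full] [F.Faithful] (hF : Function.Bijective F.obj) : IsCatIso F := by
  obtain ⟨g, hl, hr⟩ := Function.bijective_iff_has_inverse.1 hF
  refine ⟨{ obj := g
            map := fun {X Y} f => F.preimage (eqToHom (hr X) ≫ f ≫ eqToHom (hr Y).symm)
            map_id := fun X => F.map_injective (by simp)
            map_comp := fun f g => F.map_injective (by simp) }, ?_, ?_⟩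
  · refine CategoryTheory.Functor.ext hl fun X Y f => F.map_injective ?_
    simp [eqToHom_map]
  · exact CategoryTheory.Functor.ext hr fun X Y f => by simp

theorem IsDensePairing.ratFaithful_comodToMod (hκ : IsDensePairing κ)
    (hC : IsLocallyProjective R C) (M : Comod R C) :
    ratFaithful κ ((comodToMod κ).obj M) :=
  ⟨fun _ _ h => M.counital (hκ.alpha_injective hC (congrFun h)),
    rat_eq_univ_iff.2 fun m => ⟨M.coact m, fun _ => rfl⟩⟩

theorem Comod.mk_eq_self (M : Comod R C) (ϱ : M.carrier →ₗ[Rᵐᵒᵖ] Tensor R M.carrier C)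
    (h₁ : ∀ m, Tensor.assoc R (Tensor.map R ϱ LinearMap.id (ϱ m)) =
      Tensor.map R LinearMap.id (comulLeft R C) (ϱ m)) (h₂ : Function.Injective ϱ)
    (h : ϱ = M.coact) : (⟨M.carrier, ϱ, h₁, h₂⟩ : Comod R C) = M := by
  subst h; rfl

theorem RightMod.mk_eq_self (M : RightMod.{u, v, w} R A) (act : M.carrier →+ A →+ M.carrier)
    (h₁ : ∀ m a (r : R), act m (op r • a) = op r • act m a)
    (h₂ : ∀ m a (r : R), act (op r • m) a = act m (r • a))
    (h₃ : ∀ m a b, act m (a * b) = act (act m a) b)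
    (h : act = M.act) : (⟨M.carrier, act, h₁, h₂, h₃⟩ : RightMod.{u, v, w} R A) = M := by
  subst h; rfl

/-- The inverse keeps the carrier and uses the rational coaction; uniqueness of the representing
tensor recovers the original coaction. -/
theorem IsDensePairing.bijective_comodToMod (hκ : IsDensePairing κ)
    (hC : IsLocallyProjective R C) :
    Function.Bijective ((ratFaithful κ).lift (comodToMod κ)
      (hκ.ratFaithful_comodToMod hC)).obj := by
  refine Function.bijective_iff_has_inverse.2 ⟨fun M => ratComod hκ hC M.property, fun M => ?_,
    fun M => ?_⟩
  · exact Comod.mk_eq_self M _ _ _ (LinearMap.ext fun m => hκ.alpha_injective hC fun a =>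
      alpha_ratCoact hκ hC (hκ.ratFaithful_comodToMod hC M).2 m a)
  · refine ObjectProperty.FullSubcategory.ext (RightMod.mk_eq_self M.obj _ _ _ _ ?_)
    ext m a
    exact alpha_ratCoact hκ hC M.property.2 m a

theorem IsDensePairing.isCatIso_comodToMod (hκ : IsDensePairing κ)
    (hC : IsLocallyProjective R C) :
    IsCatIso ((ratFaithful κ).lift (comodToMod κ) (hκ.ratFaithful_comodToMod hC)) := by
  -- An `A`-linear map is colinear, since both sides of the colinearity equation have the same value
  -- at every `a`.
  have : ((ratFaithful κ).lift (comodToMod κ) (hκ.ratFaithful_comodToMod hC)).Full :=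
    ⟨fun {M N} f => ⟨⟨f.hom.toLin, fun m => hκ.alpha_injective hC fun a =>
      (f.hom.map_act m a).symm.trans (alpha_map f.hom.toLin (M.coact m) a).symm⟩, rfl⟩⟩
  have : ((ratFaithful κ).lift (comodToMod κ) (hκ.ratFaithful_comodToMod hC)).Faithful :=
    ⟨fun {M N} f g h => Comod.Hom.ext (congrArg (fun f => f.hom.toLin) h)⟩
  exact IsCatIso.of_bijective _ (hκ.bijective_comodToMod hC)

/-! ### Restriction of scalars -/

theorem rat_restrict {M : RightMod.{u, max u w, w} R (LeftDual R C)}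
    (hM : ratPart (selfPairing R C) M = Set.univ) :
    ratPart κ ((RightMod.restrict κ).obj M) = Set.univ :=
  rat_eq_univ_iff.2 fun m =>
    let ⟨t, ht⟩ := rat_eq_univ_iff.1 hM m
    ⟨t, fun a => ht (κ.toNonUnitalRingHom a)⟩

theorem IsDensePairing.ratFaithful_restrict (hκ : IsDensePairing κ)
    (hC : IsLocallyProjective R C) {M : RightMod.{u, max u w, w} R (LeftDual R C)}
    (hM : ratFaithful (selfPairing R C) M) :
    ratFaithful κ ((RightMod.restrict κ).obj M) := by
  refine ⟨RightMod.isFaithful_iff.2 fun m hm => RightMod.isFaithful_iff.1 hM.1 m fun f => ?_,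
    rat_restrict hM.2⟩
  obtain ⟨t, ht⟩ := rat_eq_univ_iff.1 hM.2 m
  -- Vanishing of the action on the image of `κ` kills the whole tensor, hence the action of all of
  -- `*C`.
  have h0 : t = 0 := hκ.alpha_injective hC fun a =>
    ((ht (κ.toNonUnitalRingHom a)).symm.trans (hm a)).trans (alpha_zero_right (M := M.carrier) a).symm
  rw [ht, h0, alpha_zero_right]

/-- Between rational modules, every `A`-linear map is `*C`-linear. -/
theorem IsDensePairing.map_act_of_restrict (hκ : IsDensePairing κ) (hC : IsLocallyProjective R C)
    {M N : RightMod.{u, max u w, w} R (LeftDual R C)}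
    (hM : ratPart (selfPairing R C) M = Set.univ) (hN : ratPart (selfPairing R C) N = Set.univ)
    (f : (RightMod.restrict κ).obj M ⟶ (RightMod.restrict κ).obj N)
    (m : M.carrier) (g : LeftDual R C) : f.toLin (M.act m g) = N.act (f.toLin m) g := by
  obtain ⟨s, hs⟩ := rat_eq_univ_iff.1 hM m
  obtain ⟨t, ht⟩ := rat_eq_univ_iff.1 hN (f.toLin m)
  have h : t = Tensor.map R f.toLin LinearMap.id s := hκ.alpha_injective hC fun a =>
    (ht (κ.toNonUnitalRingHom a)).symm.trans <| (f.map_act m a).symm.trans <|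
      (congrArg f.toLin (hs (κ.toNonUnitalRingHom a))).trans (alpha_map f.toLin s a).symm
  rw [ht, hs, h]
  exact (alpha_map f.toLin s g).symm

theorem IsDensePairing.isCatIso_restrict (hκ : IsDensePairing κ) (hC : IsLocallyProjective R C) :
    IsCatIso ((ratFaithful κ).lift ((ratFaithful (selfPairing R C)).ι ⋙ RightMod.restrict κ)
      fun M => hκ.ratFaithful_restrict hC M.property) := by
  set F := (ratFaithful κ).lift ((ratFaithful (selfPairing R C)).ι ⋙ RightMod.restrict κ)
    fun M => hκ.ratFaithful_restrict hC M.property with hF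
  have : F.Full :=
    ⟨fun {M N} f => ⟨ObjectProperty.homMk
      ⟨f.hom.toLin, hκ.map_act_of_restrict hC M.property.2 N.property.2 f.hom⟩, rfl⟩⟩
  have : F.Faithful :=
    ⟨fun {M N} f g h => ObjectProperty.hom_ext _
      (RightMod.Hom.ext (congrArg (fun f => f.hom.toLin) h))⟩
  refine IsCatIso.of_bijective F ?_
  -- On objects, the comodule functor for `*C` followed by restriction is definitionally the
  -- comodule functor for `A`; two of the three maps being bijective, so is the third.
  exact (Function.Bijective.of_comp_iff F.obj
    (isDensePairing_selfPairing.bijective_comodToMod hC)).1 (hκ.bijective_comodToMod hC)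

end Pairing

end CoringPairing

/-! ### The chain of isomorphisms and equalities -/

theorem mainTheorem3 {R : Type u} {A : Type v} {C : Type w} [Ring R]
    [NonUnitalRing A] [Module R A] [Module Rᵐᵒᵖ A] [CoringPairing.RRing R A]
    [AddCommGroup C] [Module R C] [Module Rᵐᵒᵖ C] [SMulCommClass R Rᵐᵒᵖ C]
    [CoringPairing.Coring R C]
    (κ : CoringPairing.RRingHom R A (CoringPairing.LeftDual R C))
    (hC : CoringPairing.IsLocallyProjective R C)
    (hκ : @Dense (CoringPairing.LeftDual R C) (CoringPairing.finiteTopology R C)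
      (Set.range κ.toNonUnitalRingHom)) :
    -- the first row, for `A`
    (∃ h : ∀ M, CoringPairing.ratFaithful κ ((CoringPairing.comodToMod κ).obj M),
      CoringPairing.IsCatIso
        ((CoringPairing.ratFaithful κ).lift (CoringPairing.comodToMod κ) h)) ∧
    CoringPairing.ratFaithful κ = CoringPairing.ratUnital κ ∧
    CoringPairing.ratUnital κ = (CoringPairing.coringMod κ).sigma ∧
    -- the second row, for `*C`
    (∃ h : ∀ M, CoringPairing.ratFaithful (CoringPairing.selfPairing R C) ((CoringPairing.comodToMod (CoringPairing.selfPairing R C)).obj M),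
      CoringPairing.IsCatIso
        ((CoringPairing.ratFaithful (CoringPairing.selfPairing R C)).lift (CoringPairing.comodToMod (CoringPairing.selfPairing R C)) h)) ∧
    CoringPairing.ratFaithful (CoringPairing.selfPairing R C) = CoringPairing.ratUnital (CoringPairing.selfPairing R C) ∧
    CoringPairing.ratUnital (CoringPairing.selfPairing R C) = (CoringPairing.coringMod (CoringPairing.selfPairing R C)).sigma ∧
    -- restriction of scalars along `κ` identifies the second row with the first
    (∃ h : ∀ M : (CoringPairing.ratFaithful (CoringPairing.selfPairing R C)).FullSubcategory,
        (CoringPairing.coringMod κ).sigma ((CoringPairing.RightMod.restrict κ).obj M.obj),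
      CoringPairing.IsCatIso ((CoringPairing.coringMod κ).sigma.lift
        ((CoringPairing.ratFaithful (CoringPairing.selfPairing R C)).ι ⋙ CoringPairing.RightMod.restrict κ) h)) := by
  have hd : CoringPairing.IsDensePairing κ := fun f F => by
    obtain ⟨_, ⟨a, rfl⟩, ha⟩ := CoringPairing.exists_eq_of_dense hκ f F
    exact ⟨a, ha⟩
  have hs : CoringPairing.IsDensePairing (CoringPairing.selfPairing R C) :=
    CoringPairing.isDensePairing_selfPairing
  refine ⟨⟨_, hd.isCatIso_comodToMod hC⟩, hd.ratFaithful_eq_ratUnital, hd.ratUnital_eq_sigma hC,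
    ⟨_, hs.isCatIso_comodToMod hC⟩, hs.ratFaithful_eq_ratUnital, hs.ratUnital_eq_sigma hC, ?_⟩
  -- The target `σ[C_A]` is replaced by the equal subcategory of faithful rational modules, where
  -- restriction was shown to be an isomorphism.
  rw [← hd.ratUnital_eq_sigma hC, ← hd.ratFaithful_eq_ratUnital]
  exact ⟨_, hd.isCatIso_restrict hC⟩
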